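/- Let $(X,\mathcal A,\mu)$ be a probability space and $T:X\to X$ an ergodic $\mu$-preserving map. For $A\in\mathcal A$ with $\mu(A)>0$ put $\varphi_A(x):=\inf\{n\ge 1:T^nx\in A\}$ (finite for a.e. $x$), $T_Ax:=T^{\varphi_A(x)}x$ (so $T_A:X\to A$ is defined a.e.), $\mu_A(B):=\mu(A\cap B)/\mu(A)$, and $$\Phi_A:=(\varphi_A,\ \varphi_A\circ T_A,\ \varphi_A\circ T_A^2,\ \ldots).$$ Let $Y\in\mathcal A$, and let $(A_l)_{l\ge1}$ be measurable subsets of $Y$ with $0<\mu(A_l)\to0$. Let $\mathfrak F$ be a compact metric space with its Borel $\sigma$-algebra, let $\psi_{A_l}:A_l\to\mathfrak F$ be measurable maps, and put $$\Psi_{A_l}:=(\psi_{A_l}\circ T_{A_l},\ \psi_{A_l}\circ T_{A_l}^2,\ \ldots).$$ For $x\in Y$ let $\varphi^Y_{A_l}(x):=\inf\{j\ge1:T_Y^jx\in A_l\}$ be the hitting time of $A_l$ under the first-return map $T_Y:Y\to Y$, and let $\Phi^Y_{A_l}:=(\varphi^Y_{A_l},\ \varphi^Y_{A_l}\circ T_{A_l},\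 \varphi^Y_{A_l}\circ T_{A_l}^2,\ldots)$ on $Y$. Let $(\Phi,\Psi)$ be a random element of $[0,\infty]^{\mathbb N_0}\times\mathfrak F^{\mathbb N}$, defined on some probability space, such that almost surely all entries of $\Phi$ are finite. Then, as $l\to\infty$, the law of $(\mu(A_l)\Phi_{A_l},\Psi_{A_l})$ under $\mu$ converges weakly to the law of $(\Phi,\Psi)$ if and only if the law of $(\mu_Y(A_l)\Phi^Y_{A_l},\Psi_{A_l})$ under $\mu_Y$ converges weakly to the law of $(\Phi,\Psi)$. Here weak convergence is that of Borel probability measures on the compact space $[0,\infty]^{\mathbb N_0}\times\mathfrak F^{\mathbb N}$ with its product topology. -/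

import Mathlib

open MeasureTheory ProbabilityTheory Filter Topology
open scoped ENNReal

namespace RareEvents

/-- The first hitting time `φ_A(x) = inf {n ≥ 1 : Tⁿ x ∈ A} ∈ {1, 2, …, ∞}` of the set `A`
under the map `T` (the infimum of the empty set being `∞`). -/
noncomputable def firstHit {X : Type*} (T : X → X) (A : Set X) (x : X) : ℕ∞ :=
  ⨅ (n : ℕ) (_ : 1 ≤ n ∧ T^[n] x ∈ A), (n : ℕ∞)

/-- The first entrance map `T_A x = T^{φ_A(x)} x`. It is only meaningful where `φ_A(x) < ∞`, which
for an ergodic system and a set of positive measure is almost everywhere; at the remaining points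
it is given the value `x`. Restricted to `A` it is the first return map of `A`. -/
noncomputable def firstEntrance {X : Type*} (T : X → X) (A : Set X) (x : X) : X :=
  T^[(firstHit T A x).toNat] x

/-- The hitting-time process `Φ_A = (φ_A, φ_A ∘ T_A, φ_A ∘ T_A², …)` of `A` under `T`, as a
sequence in `[0, ∞]`. -/
noncomputable def hittingTimeProcess {X : Type*} (T : X → X) (A : Set X) (x : X) (j : ℕ) :
    ℝ≥0∞ :=
  (firstHit T A ((firstEntrance T A)^[j] x) : ℝ≥0∞)

/-- The hitting-time process `Φ_A^Y = (φ_A^Y, φ_A^Y ∘ T_A, φ_A^Y ∘ T_A², …)` of `A ⊆ Y` under the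
first return map `T_Y`. Here `φ_A^Y` is the first hitting time of `A` under `T_Y`. It is
used on `Y` only, namely under measures concentrated on `Y`. -/
noncomputable def inducedHittingTimeProcess {X : Type*} (T : X → X) (Y A : Set X) (x : X)
    (j : ℕ) : ℝ≥0∞ :=
  (firstHit (firstEntrance T Y) A ((firstEntrance T A)^[j] x) : ℝ≥0∞)

/-- The local process `Ψ_A = (ψ_A ∘ T_A, ψ_A ∘ T_A², …)` of an observable `ψ` on `A`. The values
of `ψ` off `A` matter only at points whose orbit visits `A` finitely often. -/
noncomputable def localProcess {X F : Type*} (T : X → X) (A : Set X) (ψ : X → F) (x : X)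
    (j : ℕ) : F :=
  ψ ((firstEntrance T A)^[j + 1] x)

/-- A sequence of asymptotically rare events: measurable sets with `0 < μ (A l) → 0`. -/
structure IsAsymptoticallyRare {X : Type*} [MeasurableSpace X] (μ : Measure X)
    (A : ℕ → Set X) : Prop where
  measurableSet : ∀ l, MeasurableSet (A l)
  pos : ∀ l, 0 < μ (A l)
  tendsto_zero : Tendsto (fun l => μ (A l)) atTop (𝓝 0)

/-- A set containing rare events has positive measure, so that the normalized restriction
`μ_Y = μ(Y ∩ ·) / μ(Y)` is a probability measure. -/
theorem IsAsymptoticallyRare.isProbabilityMeasure_cond {X : Type*} [MeasurableSpace X]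
    {μ : Measure X} [IsProbabilityMeasure μ] {A : ℕ → Set X} (hA : IsAsymptoticallyRare μ A)
    {Y : Set X} (hAY : ∀ l, A l ⊆ Y) : IsProbabilityMeasure (cond μ Y) :=
  cond_isProbabilityMeasure ((hA.pos 0).trans_le (measure_mono (hAY 0))).ne'

end RareEvents

/-! The equivalence splits into two comparisons, both with the local process unchanged.

Replacing `μ` by `μ_Y` (`tendstoInDistribution_iff_cond`): off `T⁻¹ A_l`, a set of measure `μ(A_l) →
0`, composing the normalized pair with `T` only shifts the zeroth time coordinate by `μ(A_l)`. So
`h_l = f(μ(A_l) Φ, Ψ)` is asymptotically `T`-invariant for continuous `f`. Hence `∫ h_l · 1_Y ∘ T^k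
dμ` hardly depends on `k`; averaging over `k < n` replaces `1_Y` by `μ(Y)`, by the mean ergodic
theorem.

Replacing `T` by `T_Y` under `μ_Y` (`tendstoInDistribution_iff_induced`): the sum of the first `j`
induced hitting times counts the visits to `Y` up to the sum of the first `j` original ones
(`exists_hittingTimes`). Birkhoff's theorem, in the form `|S_n g - n ∫ g| ≤ C(x) + n ε`, and
`μ_Y(A_l) = μ(A_l) / μ(Y)` show that the normalized partial sums differ by at most `μ(A_l) C(x)`
plus a small multiple of themselves. They are tight because the limit is finite, so both errors
vanish in probability and `tendstoInDistribution_of_close` applies in either direction. -/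

namespace RareEvents

/-! ### Hitting times and first entrance maps along a single orbit. -/

section Dynamics

variable {X : Type*} {T : X → X} {A Y : Set X} {x : X}

theorem firstHit_eq_find (h : ∃ n, 1 ≤ n ∧ T^[n] x ∈ A)
    [DecidablePred fun n => 1 ≤ n ∧ T^[n] x ∈ A] :
    firstHit T A x = (Nat.find h : ℕ∞) :=
  le_antisymm (iInf₂_le (f := fun (n : ℕ) (_ : 1 ≤ n ∧ T^[n] x ∈ A) => (n : ℕ∞)) _
    (Nat.find_spec h)) (le_iInf₂ fun _ hn => Nat.cast_le.2 (Nat.find_min' h hn))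

theorem firstHit_eq_top_of_forall (h : ∀ n, 1 ≤ n → T^[n] x ∉ A) : firstHit T A x = ⊤ := by
  simp only [firstHit, iInf_eq_top]
  exact fun n hn => absurd hn.2 (h n hn.1)

theorem firstHit_ne_top (h : ∃ n, 1 ≤ n ∧ T^[n] x ∈ A) : firstHit T A x ≠ ⊤ := by
  classical
  simp [firstHit_eq_find h]

theorem exists_of_firstHit_ne_top (h : firstHit T A x ≠ ⊤) : ∃ n, 1 ≤ n ∧ T^[n] x ∈ A := by
  by_contra! h'
  exact h (firstHit_eq_top_of_forall h')

theorem one_le_firstHit : 1 ≤ firstHit T A x :=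
  le_iInf₂ fun _ hn => by exact_mod_cast hn.1

theorem firstHit_le {n : ℕ} (hn : 1 ≤ n) (h : T^[n] x ∈ A) : firstHit T A x ≤ n :=
  iInf₂_le (f := fun (n : ℕ) (_ : 1 ≤ n ∧ T^[n] x ∈ A) => (n : ℕ∞)) n ⟨hn, h⟩

theorem firstHit_of_mem (h : T x ∈ A) : firstHit T A x = 1 :=
  le_antisymm (firstHit_le (n := 1) le_rfl h) one_le_firstHit

theorem firstEntrance_mem (h : firstHit T A x ≠ ⊤) : firstEntrance T A x ∈ A := by
  classical
  have h' := exists_of_firstHit_ne_top h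
  rw [firstEntrance, firstHit_eq_find h']
  exact (Nat.find_spec h').2

theorem firstHit_of_notMem (h : T x ∉ A) : firstHit T A x = firstHit T A (T x) + 1 := by
  apply le_antisymm
  · by_cases htop : firstHit T A (T x) = ⊤
    · simp [htop]
    · have hmem := firstEntrance_mem htop
      rw [firstEntrance, ← Function.iterate_succ_apply] at hmem
      refine (firstHit_le (by omega) hmem).trans ?_
      simp [ENat.natCast_toNat htop]
  · refine le_iInf₂ fun n hn => ?_
    obtain ⟨m, rfl⟩ : ∃ m, n = m + 1 := ⟨n - 1, by omega⟩
    rcases Nat.eq_zero_or_pos m with rfl | hm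
    · exact absurd hn.2 h
    · push_cast
      gcongr
      exact firstHit_le hm hn.2

theorem firstHit_anti (h : A ⊆ Y) : firstHit T Y x ≤ firstHit T A x :=
  le_iInf₂ fun _ hn => firstHit_le hn.1 (h hn.2)

/-- Only times `n ≥ 1` count, so the hitting time sees a point through its image alone. -/
theorem firstHit_congr {S : X → X} {y : X} (h : S x = S y) : firstHit S A x = firstHit S A y := by
  by_cases hy : S y ∈ A
  · rw [firstHit_of_mem hy, firstHit_of_mem (h ▸ hy)]
  · rw [firstHit_of_notMem hy, firstHit_of_notMem (h ▸ hy), h]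

theorem firstEntrance_of_mem (h : T x ∈ A) : firstEntrance T A x = T x := by
  simp [firstEntrance, firstHit_of_mem h]

theorem firstEntrance_of_notMem (h : T x ∉ A) (hfin : firstHit T A (T x) ≠ ⊤) :
    firstEntrance T A x = firstEntrance T A (T x) := by
  rw [firstEntrance, firstHit_of_notMem h, ENat.toNat_add hfin (by simp)]
  simp [firstEntrance]

/-- The hitting time of `A ⊆ Y` under `T_Y` is the number of visits to `Y` up to the hitting time
of `A` under `T`. -/
theorem firstHit_firstEntrance (hAY : A ⊆ Y) {n : ℕ} (hn : firstHit T A x = n) :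
    ∃ m : ℕ, firstHit (firstEntrance T Y) A x = m ∧
      (m : ℝ) = birkhoffSum T ((T ⁻¹' Y).indicator 1) n x := by
  -- Move from `x` to `T x`. If `T x ∈ A`, both counts are 1; if `T x ∈ Y \ A`, both grow by one; if
  -- `T x ∉ Y`, then `T_Y x = T_Y (T x)` and neither changes. The indicator of `T⁻¹ Y` makes the
  -- Birkhoff sum count the times `1, …, n` instead of `0, …, n - 1`.
  induction n generalizing x with
  | zero => exact absurd (hn ▸ one_le_firstHit (T := T) (A := A) (x := x)) (by simp)
  | succ n ih =>
    by_cases hA : T x ∈ A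
    · have hn0 : n = 0 := by
        rw [firstHit_of_mem hA] at hn
        have : (1 : ℕ) = n + 1 := by exact_mod_cast hn
        omega
      subst hn0
      have hY := firstEntrance_of_mem (hAY hA)
      exact ⟨1, by rw [firstHit_of_mem (hY ▸ hA)]; rfl, by simp [hAY hA]⟩
    · rw [firstHit_of_notMem hA] at hn
      have hn' : firstHit T A (T x) = n := by
        push_cast at hn
        exact ENat.add_left_injective_of_ne_top (n := 1) (by simp) hn
      obtain ⟨m, hm, hsum⟩ := ih hn'
      by_cases hY : T x ∈ Y
      · have hE := firstEntrance_of_mem hY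
        refine ⟨m + 1, ?_, ?_⟩
        · rw [firstHit_of_notMem (hE ▸ hA), hE, hm]; rfl
        · rw [birkhoffSum_succ', ← hsum]
          simp [hY, add_comm]
      · refine ⟨m, ?_, ?_⟩
        · rw [← hm]
          refine firstHit_congr (firstEntrance_of_notMem hY fun h => ?_)
          have := firstHit_anti (T := T) (x := T x) hAY
          simp [h, hn'] at this
        · rw [birkhoffSum_succ', ← hsum]
          simp [hY]

theorem firstHit_ne_top_of_frequently (h : ∃ᶠ n in atTop, T^[n] x ∈ A) : firstHit T A x ≠ ⊤ := by
  obtain ⟨n, hn, hn'⟩ := (h.and_eventually (eventually_ge_atTop 1)).exists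
  exact firstHit_ne_top ⟨n, hn', hn⟩

theorem frequently_iterate_mem (h : ∃ᶠ n in atTop, T^[n] x ∈ A) (k : ℕ) :
    ∃ᶠ n in atTop, T^[n] (T^[k] x) ∈ A := by
  rw [frequently_atTop] at h ⊢
  intro a
  obtain ⟨b, hb, hbA⟩ := h (a + k)
  refine ⟨b - k, by omega, ?_⟩
  rwa [← Function.iterate_add_apply, Nat.sub_add_cancel (by omega)]

/-- Puts the iterates of `T_A` on the `T`-orbit, where recurrence and the cocycle identity for
Birkhoff sums are available. -/
theorem iterate_firstEntrance (T : X → X) (A : Set X) (x : X) (j : ℕ) :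
    (firstEntrance T A)^[j] x =
      T^[∑ i ∈ Finset.range j, (firstHit T A ((firstEntrance T A)^[i] x)).toNat] x := by
  induction j with
  | zero => simp
  | succ j ih =>
    rw [Function.iterate_succ_apply', Finset.sum_range_succ, add_comm,
      Function.iterate_add_apply, ← ih, firstEntrance]

theorem firstHit_iterate_firstEntrance_ne_top (h : ∃ᶠ n in atTop, T^[n] x ∈ A) (j : ℕ) :
    firstHit T A ((firstEntrance T A)^[j] x) ≠ ⊤ := by
  rw [iterate_firstEntrance]
  exact firstHit_ne_top_of_frequently (frequently_iterate_mem h _)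

theorem iterate_firstEntrance_mem (h : ∃ᶠ n in atTop, T^[n] x ∈ A) (j : ℕ) :
    (firstEntrance T A)^[j + 1] x ∈ A := by
  rw [Function.iterate_succ_apply']
  exact firstEntrance_mem (firstHit_iterate_firstEntrance_ne_top h j)

/-- Along an orbit visiting `A ⊆ Y` infinitely often, the partial sums of the hitting-time process
of `A` under `T_Y` count the visits to `Y` up to the partial sums of the process under `T`. -/
theorem exists_hittingTimes (hAY : A ⊆ Y) (h : ∃ᶠ n in atTop, T^[n] x ∈ A) :
    ∃ p q : ℕ → ℕ, (∀ j, hittingTimeProcess T A x j = p j) ∧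
      (∀ j, inducedHittingTimeProcess T Y A x j = q j) ∧
      ∀ j, ((∑ i ∈ Finset.range j, q i : ℕ) : ℝ) =
        birkhoffSum T ((T ⁻¹' Y).indicator 1) (∑ i ∈ Finset.range j, p i) x := by
  have hp : ∀ j, firstHit T A ((firstEntrance T A)^[j] x) =
      ((firstHit T A ((firstEntrance T A)^[j] x)).toNat : ℕ∞) := fun j =>
    (ENat.natCast_toNat (firstHit_iterate_firstEntrance_ne_top h j)).symm
  choose q hq hq' using fun j => firstHit_firstEntrance hAY (hp j)
  refine ⟨fun j => (firstHit T A ((firstEntrance T A)^[j] x)).toNat, q, fun j => ?_, fun j => ?_,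
    fun j => ?_⟩
  · rw [hittingTimeProcess, hp j]; simp
  · rw [inducedHittingTimeProcess, hq j]; simp
  · induction j with
    | zero => simp
    | succ j ih =>
      rw [Finset.sum_range_succ, Finset.sum_range_succ, birkhoffSum_add, ← ih,
        ← iterate_firstEntrance, ← hq' j]
      push_cast
      rfl

theorem hittingTimeProcess_zero_of_notMem (h : T x ∉ A) :
    hittingTimeProcess T A x 0 = hittingTimeProcess T A (T x) 0 + 1 := by
  simp [hittingTimeProcess, firstHit_of_notMem h]

theorem iterate_firstEntrance_of_notMem (h : T x ∉ A) (hfin : firstHit T A (T x) ≠ ⊤) (j : ℕ) :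
    (firstEntrance T A)^[j + 1] x = (firstEntrance T A)^[j + 1] (T x) := by
  rw [Function.iterate_succ_apply, Function.iterate_succ_apply, firstEntrance_of_notMem h hfin]

theorem hittingTimeProcess_succ_of_notMem (h : T x ∉ A) (hfin : firstHit T A (T x) ≠ ⊤) (j : ℕ) :
    hittingTimeProcess T A x (j + 1) = hittingTimeProcess T A (T x) (j + 1) := by
  rw [hittingTimeProcess, hittingTimeProcess, iterate_firstEntrance_of_notMem h hfin]

theorem localProcess_of_notMem {F : Type*} (ψ : X → F) (h : T x ∉ A)
    (hfin : firstHit T A (T x) ≠ ⊤) : localProcess T A ψ x = localProcess T A ψ (T x) :=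
  funext fun j => by rw [localProcess, localProcess, iterate_firstEntrance_of_notMem h hfin]

end Dynamics

/-! ### Running maxima of Birkhoff sums. -/

section BirkhoffMax

variable {X : Type*} {T : X → X}

/-- The running maximum `max_{0 ≤ k ≤ n} S_k f` of the Birkhoff sums. -/
noncomputable def birkhoffMax (T : X → X) (f : X → ℝ) : ℕ → X → ℝ
  | 0 => 0
  | n + 1 => fun x => max 0 (f x + birkhoffMax T f n (T x))

theorem birkhoffMax_succ (f : X → ℝ) (n : ℕ) (x : X) :
    birkhoffMax T f (n + 1) x = max 0 (f x + birkhoffMax T f n (T x)) := rfl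

theorem birkhoffMax_nonneg (f : X → ℝ) (n : ℕ) (x : X) : 0 ≤ birkhoffMax T f n x := by
  cases n
  · exact le_rfl
  · exact le_max_left _ _

theorem birkhoffMax_le_succ (f : X → ℝ) (n : ℕ) (x : X) :
    birkhoffMax T f n x ≤ birkhoffMax T f (n + 1) x := by
  induction n generalizing x with
  | zero => exact birkhoffMax_nonneg f 1 x
  | succ n ih =>
    rw [birkhoffMax_succ, birkhoffMax_succ f (n + 1)]
    exact max_le_max le_rfl (by gcongr; exact ih (T x))

theorem birkhoffSum_le_birkhoffMax (f : X → ℝ) (n : ℕ) (x : X) :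
    birkhoffSum T f n x ≤ birkhoffMax T f n x := by
  induction n generalizing x with
  | zero => simp [birkhoffMax]
  | succ n ih =>
    rw [birkhoffSum_succ', birkhoffMax_succ]
    exact le_max_of_le_right (by gcongr; exact ih (T x))

theorem integrable_birkhoffMax [MeasurableSpace X] {μ : Measure X}
    (hT : MeasurePreserving T μ μ) {f : X → ℝ} (hf : Integrable f μ) (n : ℕ) : Integrable (birkhoffMax T f n) μ := by
  induction n with
  | zero => exact integrable_zero _ _ _
  | succ n ih =>
    exact (integrable_zero _ _ _).sup (hf.add (hT.integrable_comp_of_integrable ih))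

end BirkhoffMax

/-! ### Recurrence and a pointwise ergodic bound. -/

section Ergodic

variable {X : Type*} [MeasurableSpace X] {μ : Measure X} {T : X → X}

/-- The set of such points is invariant, hence null or conull, and Poincaré recurrence puts almost
all of `A` in it. -/
theorem ae_frequently_iterate_mem [IsFiniteMeasure μ] (hT : Ergodic T μ) {A : Set X}
    (hA : MeasurableSet A) (hpos : 0 < μ A) : ∀ᵐ x ∂μ, ∃ᶠ n in atTop, T^[n] x ∈ A := by
  have hmeas : MeasurableSet {x | ∃ᶠ n in atTop, T^[n] x ∈ A} := by
    have : {x | ∃ᶠ n in atTop, T^[n] x ∈ A} = limsup (fun n => T^[n] ⁻¹' A) atTop := by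
      ext x
      simp [mem_limsup_iff_frequently_mem]
    rw [this]
    exact MeasurableSet.measurableSet_limsup fun n => (hT.measurable.iterate n) hA
  have hinv : T ⁻¹' {x | ∃ᶠ n in atTop, T^[n] x ∈ A} = {x | ∃ᶠ n in atTop, T^[n] x ∈ A} := by
    ext x
    refine ⟨fun h => ?_, fun h => frequently_iterate_mem h 1⟩
    rw [Set.mem_preimage, Set.mem_ofPred_eq] at h
    simp_rw [← Function.iterate_succ_apply] at h
    exact (tendsto_add_atTop_nat 1).frequently h
  rcases hT.ae_mem_or_ae_notMem hmeas hinv with h | h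
  · exact h
  · refine absurd ?_ hpos.ne'
    refine measure_eq_zero_iff_ae_notMem.2 ?_
    filter_upwards [h, hT.conservative.ae_mem_imp_frequently_image_mem hA.nullMeasurableSet]
      with x hx hx' hxA using hx (hx' hxA)

/-- If `∫ f < 0`, the Birkhoff sums of `f` are almost everywhere bounded above. -/
theorem ae_bddAbove_birkhoffSum (hT : Ergodic T μ) {f : X → ℝ} (hfm : Measurable f)
    (hf : Integrable f μ) (hneg : ∫ x, f x ∂μ < 0) :
    ∀ᵐ x ∂μ, BddAbove (Set.range fun n => birkhoffSum T f n x) := by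
  have hmeas : MeasurableSet {x | BddAbove (Set.range fun n => birkhoffSum T f n x)} :=
    measurableSet_bddAbove_range fun n => Finset.measurable_sum _ fun k _ =>
      hfm.comp (hT.measurable.iterate k)
  have hinv : T ⁻¹' {x | BddAbove (Set.range fun n => birkhoffSum T f n x)} =
      {x | BddAbove (Set.range fun n => birkhoffSum T f n x)} := by
    ext x
    simp only [Set.mem_preimage, Set.mem_ofPred_eq]
    constructor
    · rintro ⟨C, hC⟩
      refine ⟨max 0 (f x + C), ?_⟩
      rintro _ ⟨n, rfl⟩
      cases n with
      | zero => simp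
      | succ n =>
        simp only [birkhoffSum_succ']
        exact le_max_of_le_right (by gcongr; exact hC ⟨n, rfl⟩)
    · rintro ⟨C, hC⟩
      refine ⟨C - f x, ?_⟩
      rintro _ ⟨n, rfl⟩
      have := hC ⟨n + 1, rfl⟩
      simp only [birkhoffSum_succ'] at this
      simp only
      linarith
  -- Otherwise the sums are unbounded above almost everywhere. With `M_n` the running maximum,
  -- `M_{n+1} - M_n ∘ T = max (-M_n ∘ T) f` is dominated by `|f|` and eventually equals `f`. Its
  -- integral is nonnegative because `M_n ≤ M_{n+1}` and `μ` is invariant; in the limit `∫ f ≥ 0`.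
  refine (hT.ae_mem_or_ae_notMem hmeas hinv).resolve_right fun hunb => hneg.not_ge ?_
  have hTM : ∀ n, Integrable (fun x => birkhoffMax T f n (T x)) μ := fun n =>
    hT.toMeasurePreserving.integrable_comp_of_integrable
      (integrable_birkhoffMax hT.toMeasurePreserving hf n)
  have hlim : Tendsto (fun n => ∫ x, (birkhoffMax T f (n + 1) x - birkhoffMax T f n (T x)) ∂μ) atTop
      (𝓝 (∫ x, f x ∂μ)) := by
    refine tendsto_integral_of_dominated_convergence (fun x => |f x|) (fun n => ?_) hf.abs
      (fun n => ?_) ?_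
    · exact ((integrable_birkhoffMax hT.toMeasurePreserving hf _).sub (hTM n)).aestronglyMeasurable
    · refine .of_forall fun x => ?_
      have h0 := birkhoffMax_nonneg (T := T) f n (T x)
      rw [birkhoffMax_succ, Real.norm_eq_abs]
      rcases le_total 0 (f x + birkhoffMax T f n (T x)) with h | h
      · rw [max_eq_right h, add_sub_cancel_right]
      · rw [max_eq_left h, abs_of_nonpos (by linarith), abs_of_nonpos (by linarith)]
        linarith
    · filter_upwards [hunb, hT.quasiMeasurePreserving.ae hunb] with x _ hx
      refine tendsto_const_nhds.congr' ?_
      have hmono : Monotone fun n => birkhoffMax T f n (T x) :=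
        monotone_nat_of_le_succ fun n => birkhoffMax_le_succ f n (T x)
      have : ∃ n, -f x < birkhoffSum T f n (T x) := by
        by_contra! h
        exact hx ⟨-f x, by rintro _ ⟨n, rfl⟩; exact h n⟩
      obtain ⟨n, hn⟩ := this
      filter_upwards [eventually_ge_atTop n] with m hm
      have h1 := birkhoffSum_le_birkhoffMax (T := T) f n (T x)
      have h2 := hmono hm
      simp only at h2
      rw [birkhoffMax_succ, max_eq_right (by linarith), add_sub_cancel_right]
  refine ge_of_tendsto' hlim fun n => ?_
  rw [integral_sub (integrable_birkhoffMax hT.toMeasurePreserving hf _) (hTM n), sub_nonneg]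
  have hcomp : ∫ x, birkhoffMax T f n (T x) ∂μ = ∫ x, birkhoffMax T f n x ∂μ := by
    conv_rhs => rw [← hT.map_eq]
    rw [integral_map hT.measurable.aemeasurable]
    rw [hT.map_eq]
    exact (integrable_birkhoffMax hT.toMeasurePreserving hf n).aestronglyMeasurable
  rw [hcomp]
  exact integral_mono (integrable_birkhoffMax hT.toMeasurePreserving hf _)
    (integrable_birkhoffMax hT.toMeasurePreserving hf _) fun x => birkhoffMax_le_succ f n x

/-- A quantitative form of Birkhoff's ergodic theorem. -/
theorem exists_abs_birkhoffSum_sub_le [IsProbabilityMeasure μ] (hT : Ergodic T μ) {g : X → ℝ}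
    (hgm : Measurable g) (hg : Integrable g μ) {ε : ℝ} (hε : 0 < ε) :
    ∃ C : X → ℝ, Measurable C ∧ ∀ᵐ x ∂μ, ∀ n : ℕ,
      |birkhoffSum T g n x - n * ∫ y, g y ∂μ| ≤ C x + n * ε := by
  set c := ∫ y, g y ∂μ with hc
  have h1 := ae_bddAbove_birkhoffSum (f := fun x => g x - (c + ε)) hT (hgm.sub_const _)
    (hg.sub (integrable_const _))
    (by rw [integral_sub hg (integrable_const _)]; simp [← hc, hε])
  have h2 := ae_bddAbove_birkhoffSum (f := fun x => (c - ε) - g x) hT (hgm.const_sub _)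
    ((integrable_const _).sub hg)
    (by rw [integral_sub (integrable_const _) hg]; simp [← hc, hε])
  have e1 : ∀ n x, birkhoffSum T (fun x => g x - (c + ε)) n x =
      birkhoffSum T g n x - n * (c + ε) := fun n x => by
    simp [birkhoffSum, Finset.sum_sub_distrib, mul_add]
  have e2 : ∀ n x, birkhoffSum T (fun x => (c - ε) - g x) n x =
      n * (c - ε) - birkhoffSum T g n x := fun n x => by
    simp [birkhoffSum, Finset.sum_sub_distrib, mul_sub]
  -- The least possible `C`. The supremum is finite almost everywhere because `g - (c + ε)` and `(c
  -- - ε) - g` both have negative integral, so their Birkhoff sums are bounded above.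
  refine ⟨fun x => ⨆ n : ℕ, (|birkhoffSum T g n x - n * c| - n * ε), ?_, ?_⟩
  · refine Measurable.iSup fun n => ?_
    have : Measurable fun x => birkhoffSum T g n x :=
      Finset.measurable_sum _ fun k _ => hgm.comp (hT.measurable.iterate k)
    fun_prop
  · filter_upwards [h1, h2] with x hx1 hx2 n
    obtain ⟨C1, hC1⟩ := hx1
    obtain ⟨C2, hC2⟩ := hx2
    rw [← sub_le_iff_le_add]
    refine le_ciSup (f := fun n : ℕ => |birkhoffSum T g n x - n * c| - n * ε)
      ⟨max C1 C2, ?_⟩ n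
    rintro _ ⟨m, rfl⟩
    have h1 := hC1 ⟨m, rfl⟩
    have h2 := hC2 ⟨m, rfl⟩
    simp only [e1, e2] at h1 h2
    simp only
    rcases abs_cases (birkhoffSum T g m x - m * c) with ⟨h, _⟩ | ⟨h, _⟩ <;> rw [h]
    · exact le_max_of_le_left (by linarith)
    · exact le_max_of_le_right (by linarith)

end Ergodic

/-! ### Measurability of the processes. -/

section Measurability

variable {X : Type*} [MeasurableSpace X] {T : X → X} {A Y : Set X}

theorem measurable_firstHit (hT : Measurable T) (hA : MeasurableSet A) :
    Measurable (firstHit T A) := by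
  refine measurable_to_countable' fun n => ?_
  have key : ∀ m : ℕ, MeasurableSet {x | firstHit T A x ≤ m} := fun m => by
    have : {x | firstHit T A x ≤ m} = ⋃ k ∈ Finset.Icc 1 m, T^[k] ⁻¹' A := by
      ext x
      simp only [Set.mem_ofPred_eq, Set.mem_iUnion, Finset.mem_Icc, Set.mem_preimage, exists_prop]
      constructor
      · intro h
        have hne : firstHit T A x ≠ ⊤ := (h.trans_lt (ENat.natCast_lt_top m)).ne
        have hcoe := ENat.natCast_toNat hne
        refine ⟨(firstHit T A x).toNat, ⟨?_, ?_⟩, firstEntrance_mem hne⟩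
        · have := one_le_firstHit (T := T) (A := A) (x := x)
          rw [← hcoe] at this
          exact_mod_cast this
        · rw [← hcoe] at h
          exact_mod_cast h
      · rintro ⟨k, hk, hkA⟩
        exact (firstHit_le hk.1 hkA).trans (by exact_mod_cast hk.2)
    rw [this]
    exact Finset.measurableSet_biUnion _ fun k _ => (hT.iterate k) hA
  have key' : ∀ m : ℕ, MeasurableSet {x | firstHit T A x < m} := fun m => by
    cases m with
    | zero => simp
    | succ m =>
      convert key m using 3 with x
      push_cast
      exact ENat.lt_add_one_iff (ENat.natCast_ne_top m)
  induction n with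
  | top =>
    have : firstHit T A ⁻¹' {⊤} = ⋂ m : ℕ, {x | firstHit T A x ≤ m}ᶜ := by
      ext x
      simp only [Set.mem_preimage, Set.mem_singleton_iff, Set.mem_iInter, Set.mem_compl_iff,
        Set.mem_ofPred_eq, not_le]
      exact ENat.eq_top_iff_forall_gt
    rw [this]
    exact .iInter fun m => (key m).compl
  | coe m =>
    have : firstHit T A ⁻¹' {(m : ℕ∞)} =
        {x | firstHit T A x ≤ m} \ {x | firstHit T A x < m} := by
      ext x
      simp [le_antisymm_iff]
    rw [this]
    exact (key m).diff (key' m)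

theorem measurable_firstEntrance (hT : Measurable T) (hA : MeasurableSet A) :
    Measurable (firstEntrance T A) := by
  have h : Measurable fun p : X × ℕ => T^[p.2] p.1 :=
    measurable_from_prod_countable_left fun n => hT.iterate n
  exact h.comp (measurable_id.prodMk
    ((measurable_from_top (f := ENat.toNat)).comp (measurable_firstHit hT hA)))

theorem measurable_hittingTimeProcess (hT : Measurable T) (hA : MeasurableSet A) :
    Measurable (hittingTimeProcess T A) :=
  measurable_pi_lambda _ fun j =>
    (measurable_from_top (f := fun n : ℕ∞ => (n : ℝ≥0∞))).comp
      ((measurable_firstHit hT hA).comp ((measurable_firstEntrance hT hA).iterate j))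

theorem measurable_inducedHittingTimeProcess (hT : Measurable T) (hA : MeasurableSet A)
    (hY : MeasurableSet Y) : Measurable (inducedHittingTimeProcess T Y A) :=
  measurable_pi_lambda _ fun j =>
    (measurable_from_top (f := fun n : ℕ∞ => (n : ℝ≥0∞))).comp
      ((measurable_firstHit (measurable_firstEntrance hT hY) hA).comp
        ((measurable_firstEntrance hT hA).iterate j))

/-- Only the values of `ψ` on `A` enter along a recurrent orbit, so off `A` it may be replaced by a
constant. -/
theorem aemeasurable_localProcess {F : Type*} [MeasurableSpace F] {ν : Measure X}
    (hT : Measurable T) (hA : MeasurableSet A) {ψ : X → F} (hψ : Measurable (A.domRestrict ψ))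
    (hrec : ∀ᵐ x ∂ν, ∃ᶠ n in atTop, T^[n] x ∈ A) : AEMeasurable (localProcess T A ψ) ν := by
  rcases isEmpty_or_nonempty X with hX | ⟨⟨x₀⟩⟩
  · exact (measurable_of_empty _).aemeasurable
  classical
  have hψ' : Measurable (A.piecewise ψ fun _ => ψ x₀) := by
    refine measurable_of_restrict_of_restrict_compl hA ?_ ?_
    · rwa [Set.domRestrict_piecewise]
    · rw [Set.domRestrict_piecewise_compl]
      exact measurable_const
  refine ⟨localProcess T A (A.piecewise ψ fun _ => ψ x₀), ?_, ?_⟩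
  · exact measurable_pi_lambda _ fun j =>
      hψ'.comp ((measurable_firstEntrance hT hA).iterate (j + 1))
  · filter_upwards [hrec] with x hx
    funext j
    exact (Set.piecewise_eq_of_mem _ _ _ (iterate_firstEntrance_mem hx j)).symm

end Measurability

/-! ### Small exceptional sets and integrals. -/

section Integrals

variable {X : Type*} [MeasurableSpace X] {ν : Measure X} [IsProbabilityMeasure ν]

/-- Uniformly bounded functions which tend to zero in measure tend to zero in mean. -/
theorem tendsto_integral_abs_of_small {g : ℕ → X → ℝ} {M : ℝ} (hM : ∀ l x, |g l x| ≤ M)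
    (h : ∀ ε > 0, ∀ δ : ℝ≥0∞, 0 < δ → ∀ᶠ l in atTop, ∃ B : Set X, ν B ≤ δ ∧
      ∀ᵐ x ∂ν, x ∉ B → |g l x| ≤ ε) :
    Tendsto (fun l => ∫ x, |g l x| ∂ν) atTop (𝓝 0) := by
  obtain ⟨x₀⟩ := ν.nonempty_of_neZero
  have hM0 : 0 ≤ M := (abs_nonneg _).trans (hM 0 x₀)
  rw [Metric.tendsto_nhds]
  intro ε hε
  have hδ : 0 < ε / 3 / (M + 1) := by positivity
  filter_upwards [h (ε / 3) (by positivity) (ENNReal.ofReal (ε / 3 / (M + 1)))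
    (by simpa using hδ)] with l hl
  obtain ⟨B, hB, hsmall⟩ := hl
  -- `B` need not be measurable; its measurable hull has the same measure.
  set B' := toMeasurable ν B
  have hB' : ν.real B' ≤ ε / 3 / (M + 1) := by
    rw [measureReal_def, measure_toMeasurable]
    exact ENNReal.toReal_le_of_le_ofReal hδ.le hB
  have hint : Integrable (fun x => ε / 3 + B'.indicator (fun _ => M) x) ν :=
    (integrable_const _).add ((integrable_const M).indicator (measurableSet_toMeasurable ν B))
  have hle : ∫ x, |g l x| ∂ν ≤ ∫ x, (ε / 3 + B'.indicator (fun _ => M) x) ∂ν := by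
    refine integral_mono_of_nonneg (.of_forall fun x => abs_nonneg _) hint ?_
    filter_upwards [hsmall] with x hx
    by_cases hxB : x ∈ B'
    · simp only [Set.indicator_of_mem hxB]
      linarith [hM l x]
    · simp only [Set.indicator_of_notMem hxB, add_zero]
      exact hx fun h => hxB (subset_toMeasurable ν B h)
  rw [integral_add (integrable_const _)
    ((integrable_const M).indicator (measurableSet_toMeasurable ν B)),
    integral_indicator_const _ (measurableSet_toMeasurable ν B)] at hle
  simp only [integral_const, probReal_univ, smul_eq_mul] at hle
  have h3 : ν.real B' * M ≤ ε / 3 := by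
    calc ν.real B' * M ≤ ε / 3 / (M + 1) * (M + 1) := by gcongr; linarith
      _ = ε / 3 := by field_simp
  rw [Real.dist_eq, sub_zero, abs_of_nonneg (integral_nonneg fun x => abs_nonneg _)]
  linarith

theorem exists_measure_lt_le {C : X → ℝ} (hC : Measurable C) {δ : ℝ≥0∞} (hδ : 0 < δ) :
    ∃ L : ℝ, 0 ≤ L ∧ ν {x | L < C x} ≤ δ := by
  have hlim : Tendsto (ν ∘ fun n : ℕ => {x | (n : ℝ) < C x}) atTop
      (𝓝 (ν (⋂ n : ℕ, {x | (n : ℝ) < C x}))) := by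
    refine tendsto_measure_iInter_atTop
      (fun n => (measurableSet_lt measurable_const hC).nullMeasurableSet) ?_ ⟨0, by simp⟩
    intro m n hmn x hx
    simp only [Set.mem_ofPred_eq] at hx ⊢
    exact lt_of_le_of_lt (by exact_mod_cast hmn) hx
  have hempty : ⋂ n : ℕ, {x | (n : ℝ) < C x} = ∅ := by
    refine Set.eq_empty_of_forall_notMem fun x hx => ?_
    obtain ⟨n, hn⟩ := exists_nat_gt (C x)
    exact (Set.mem_iInter.1 hx n).not_gt hn
  rw [hempty, measure_empty] at hlim
  obtain ⟨n, hn⟩ := (hlim.eventually_le_const hδ).exists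
  exact ⟨n, n.cast_nonneg, hn⟩

end Integrals

/-! ### Uniform continuity on the sequence space. -/

section Uniform

variable {F : Type*} [TopologicalSpace F]

/-- On finite values the isomorphism is `w ↦ 1 - 1 / (1 + w)`, which is 1-Lipschitz. -/
theorem abs_orderIsoUnitIntervalBirational_sub_le {u v : ℝ≥0∞} (hu : u ≠ ∞) (hv : v ≠ ∞) :
    dist (ENNReal.orderIsoUnitIntervalBirational u) (ENNReal.orderIsoUnitIntervalBirational v) ≤
      |u.toReal - v.toReal| := by
  have key : ∀ w : ℝ≥0∞, w ≠ ∞ →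
      ((ENNReal.orderIsoUnitIntervalBirational w : Set.Icc (0 : ℝ) 1) : ℝ) =
        1 - 1 / (1 + w.toReal) := fun w hw => by
    rw [ENNReal.orderIsoUnitIntervalBirational_apply_coe]
    lift w to NNReal using hw
    rcases eq_or_ne w 0 with rfl | h0
    · simp
    · have h0' : (w : ℝ) ≠ 0 := by exact_mod_cast h0
      have h1 : (1 : ℝ) + w ≠ 0 := by positivity
      rw [ENNReal.toReal_inv, ENNReal.toReal_add (by simpa using h0) (by simp),
        ENNReal.toReal_inv]
      simp only [ENNReal.coe_toReal, ENNReal.toReal_one]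
      field_simp
      ring
  rw [Subtype.dist_eq, Real.dist_eq, key u hu, key v hv]
  have h1 : 0 ≤ u.toReal := ENNReal.toReal_nonneg
  have h2 : 0 ≤ v.toReal := ENNReal.toReal_nonneg
  have : 1 - 1 / (1 + u.toReal) - (1 - 1 / (1 + v.toReal)) =
      (u.toReal - v.toReal) / ((1 + u.toReal) * (1 + v.toReal)) := by
    field_simp
    ring
  rw [this, abs_div]
  refine div_le_self (abs_nonneg _) ?_
  rw [abs_of_nonneg (by positivity)]
  nlinarith

/-- A continuous function on `[0, ∞]^ℕ × F^ℕ` depends, up to `ε`, uniformly continuously on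
finitely many of the `[0, ∞]`-coordinates. -/
theorem exists_forall_abs_sub_lt [CompactSpace F] {f : (ℕ → ℝ≥0∞) × (ℕ → F) → ℝ}
    (hf : Continuous f) {ε : ℝ} (hε : 0 < ε) :
    ∃ J : ℕ, ∃ δ > 0, ∀ u v : ℕ → ℝ≥0∞, ∀ w : ℕ → F,
      (∀ j < J, u j ≠ ∞ ∧ v j ≠ ∞ ∧ |(u j).toReal - (v j).toReal| < δ) →
        |f (u, w) - f (v, w)| < ε := by
  let e := ENNReal.orderIsoUnitIntervalBirational.toHomeomorph
  -- Currying into the sup-norm space `C(F^ℕ, ℝ)` makes the estimate uniform in `w`; compactness of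
  -- `[0, 1]^ℕ` gives uniform continuity, and an entourage of the product constrains only finitely
  -- many coordinates.
  let G : C(ℕ → Set.Icc (0 : ℝ) 1, C(ℕ → F, ℝ)) := ContinuousMap.curry
    ⟨fun p => f (fun j => e.symm (p.1 j), p.2), by fun_prop⟩
  have hG : UniformContinuous G := CompactSpace.uniformContinuous_of_continuous G.continuous
  have hmem := hG (Metric.dist_mem_uniformity hε)
  rw [Filter.mem_map, Pi.uniformity, Filter.mem_iInf] at hmem
  obtain ⟨I, hI, V, hV, hVeq⟩ := hmem
  have : ∀ i : I, ∃ δ > 0, ∀ p : (ℕ → Set.Icc (0 : ℝ) 1) × (ℕ → Set.Icc (0 : ℝ) 1),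
      dist (p.1 i) (p.2 i) < δ → p ∈ V i := fun i => by
    obtain ⟨t, ht, htV⟩ := Filter.mem_comap.1 (hV i)
    obtain ⟨δ, hδ, hδt⟩ := Metric.mem_uniformity_dist.1 ht
    exact ⟨δ, hδ, fun p hp => htV (hδt hp)⟩
  choose d hd hdV using this
  have := hI.fintype
  obtain ⟨δ, hδ, hδd⟩ : ∃ δ > 0, ∀ i : I, δ ≤ d i := by
    obtain ⟨δ, hδ, h⟩ := Filter.Eventually.exists
      (((Filter.eventually_all (l := 𝓝[>] (0 : ℝ))).2 fun i : I =>
        nhdsWithin_le_nhds (eventually_le_nhds (hd i))).and self_mem_nhdsWithin)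
    exact ⟨δ, h, hδ⟩
  obtain ⟨J, hJ⟩ := hI.bddAbove
  refine ⟨J + 1, δ, hδ, fun u v w huv => ?_⟩
  have hclose : (fun j => e (u j), fun j => e (v j)) ∈ ⋂ i, V i := by
    refine Set.mem_iInter.2 fun i => hdV i _ ?_
    obtain ⟨h1, h2, h3⟩ := huv i (Nat.lt_succ_of_le (hJ i.2))
    exact (abs_orderIsoUnitIntervalBirational_sub_le h1 h2).trans_lt (h3.trans_le (hδd i))
  rw [← hVeq] at hclose
  have hdist := (ContinuousMap.dist_apply_le_dist w).trans_lt hclose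
  simpa [G, Real.dist_eq] using hdist

end Uniform

/-! ### Stability of convergence in distribution. -/

section Convergence

variable {X Ω E : Type*} [MeasurableSpace X] {ν : Measure X} [IsProbabilityMeasure ν]
  [MeasurableSpace Ω] {P : Measure Ω} [IsProbabilityMeasure P]

theorem tendstoInDistribution_iff_integral [TopologicalSpace E] [MeasurableSpace E]
    [OpensMeasurableSpace E] {R : ℕ → X → E} {Z : Ω → E} (hR : ∀ l, AEMeasurable (R l) ν)
    (hZ : AEMeasurable Z P) :
    TendstoInDistribution R atTop Z (fun _ => ν) P ↔
      ∀ f : BoundedContinuousFunction E ℝ,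
        Tendsto (fun l => ∫ x, f (R l x) ∂ν) atTop (𝓝 (∫ ω, f (Z ω) ∂P)) := by
  have key : TendstoInDistribution R atTop Z (fun _ => ν) P ↔ Tendsto (β := ProbabilityMeasure E)
      (fun n ↦ ⟨ν.map (R n), Measure.isProbabilityMeasure_map (hR n)⟩) atTop
      (𝓝 ⟨P.map Z, Measure.isProbabilityMeasure_map hZ⟩) :=
    ⟨fun h => h.tendsto, fun h => ⟨hR, hZ, h⟩⟩
  refine key.trans (ProbabilityMeasure.tendsto_iff_forall_integral_tendsto.trans ?_)
  refine forall_congr' fun f => ?_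
  simp only [ProbabilityMeasure.coe_mk]
  rw [integral_map hZ f.continuous.aestronglyMeasurable]
  simp_rw [fun l => integral_map (hR l) (f.continuous.aestronglyMeasurable (μ := ν.map (R l)))]

variable {F : Type*} [MetricSpace F] [CompactSpace F] [MeasurableSpace F] [BorelSpace F]

/-- Tightness of the partial sums: the closed sets `{K ≤ sum}` decrease to a null set of the limit
law, whose time entries are finite, and the portmanteau inequality for closed sets carries the bound
back to large `l`. -/
theorem exists_eventually_measure_sum_ge_lt {U : ℕ → X → ℕ → ℝ≥0∞} {W : ℕ → X → ℕ → F}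
    {Φ : Ω → ℕ → ℝ≥0∞} {Ψ : Ω → ℕ → F} (hΦ_fin : ∀ᵐ ω ∂P, ∀ j, Φ ω j < ∞)
    (h : TendstoInDistribution (fun l x => (U l x, W l x)) atTop (fun ω => (Φ ω, Ψ ω))
      (fun _ => ν) P) (J : ℕ) {δ : ℝ≥0∞} (hδ : 0 < δ) :
    ∃ K : ℕ, ∀ᶠ l in atTop, ν {x | (K : ℝ≥0∞) ≤ ∑ i ∈ Finset.range J, U l x i} < δ := by
  let S : ℕ → Set ((ℕ → ℝ≥0∞) × (ℕ → F)) := fun K =>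
    {e | (K : ℝ≥0∞) ≤ ∑ i ∈ Finset.range J, e.1 i}
  have hS : ∀ K, IsClosed (S K) := fun K => isClosed_le continuous_const
    (continuous_finsetSum _ fun i _ => (continuous_apply i).comp continuous_fst)
  have hZ := h.aemeasurable_limit
  have : IsProbabilityMeasure (P.map fun ω => (Φ ω, Ψ ω)) := Measure.isProbabilityMeasure_map hZ
  have hlim : Tendsto ((P.map fun ω => (Φ ω, Ψ ω)) ∘ S) atTop
      (𝓝 ((P.map fun ω => (Φ ω, Ψ ω)) (⋂ K, S K))) := by
    refine tendsto_measure_iInter_atTop (fun K => (hS K).measurableSet.nullMeasurableSet) ?_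
      ⟨0, measure_ne_top _ _⟩
    intro m n hmn e he
    simp only [S, Set.mem_ofPred_eq] at he ⊢
    exact le_trans (by exact_mod_cast hmn) he
  have hnull : (P.map fun ω => (Φ ω, Ψ ω)) (⋂ K, S K) = 0 := by
    rw [Measure.map_apply_of_aemeasurable hZ (.iInter fun K => (hS K).measurableSet)]
    refine measure_eq_zero_iff_ae_notMem.2 ?_
    filter_upwards [hΦ_fin] with ω hω hmem
    have hfin : ∑ i ∈ Finset.range J, Φ ω i ≠ ∞ :=
      (ENNReal.sum_lt_top.2 fun i _ => hω i).ne
    obtain ⟨n, hn⟩ := ENNReal.exists_nat_gt hfin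
    exact (Set.mem_iInter.1 hmem n : (n : ℝ≥0∞) ≤ ∑ i ∈ Finset.range J, Φ ω i).not_gt hn
  rw [hnull] at hlim
  obtain ⟨K, hK⟩ := (hlim.eventually_lt_const hδ).exists
  refine ⟨K, ?_⟩
  let _ : MetricSpace ((ℕ → ℝ≥0∞) × (ℕ → F)) := TopologicalSpace.metrizableSpaceMetric _
  have hlimsup := ProbabilityMeasure.limsup_measure_closed_le_of_tendsto h.tendsto (hS K)
  filter_upwards [eventually_lt_of_limsup_lt (hlimsup.trans_lt hK)] with l hl
  simp only [ProbabilityMeasure.coe_mk] at hl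
  rwa [Measure.map_apply_of_aemeasurable (h.forall_aemeasurable l) (hS K).measurableSet] at hl

/-- If the partial sums of `V l` are close to those of `U l`, up to an error which is small
relative to the latter, then convergence in distribution to a finite limit passes from `U` to
`V`. -/
theorem tendstoInDistribution_of_close {U V : ℕ → X → ℕ → ℝ≥0∞} {W : ℕ → X → ℕ → F}
    {Φ : Ω → ℕ → ℝ≥0∞} {Ψ : Ω → ℕ → F} (hΦ_fin : ∀ᵐ ω ∂P, ∀ j, Φ ω j < ∞)
    (hU : TendstoInDistribution (fun l x => (U l x, W l x)) atTop (fun ω => (Φ ω, Ψ ω))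
      (fun _ => ν) P)
    (hV : ∀ l, AEMeasurable (fun x => (V l x, W l x)) ν)
    {a : ℕ → ℝ} (ha : Tendsto a atTop (𝓝 0)) (ha0 : ∀ l, 0 ≤ a l)
    (hfin : ∀ᵐ x ∂ν, ∀ l j, U l x j ≠ ∞ ∧ V l x j ≠ ∞)
    (hclose : ∀ ε > 0, ∃ C : X → ℝ, Measurable C ∧ ∀ᵐ x ∂ν, ∀ l j,
      |∑ i ∈ Finset.range j, (V l x i).toReal - ∑ i ∈ Finset.range j, (U l x i).toReal| ≤
        a l * C x + ε * ∑ i ∈ Finset.range j, (U l x i).toReal) :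
    TendstoInDistribution (fun l x => (V l x, W l x)) atTop (fun ω => (Φ ω, Ψ ω))
      (fun _ => ν) P := by
  have hZ := hU.aemeasurable_limit
  have hUm := hU.forall_aemeasurable
  rw [tendstoInDistribution_iff_integral hV hZ]
  intro f
  have hUf := (tendstoInDistribution_iff_integral hUm hZ).1 hU f
  have hint : ∀ R : X → (ℕ → ℝ≥0∞) × (ℕ → F), AEMeasurable R ν →
      Integrable (fun x => f (R x)) ν := fun R hR =>
    Integrable.of_bound (f.continuous.measurable.comp_aemeasurable hR).aestronglyMeasurable ‖f‖
      (.of_forall fun x => f.norm_coe_le_norm _)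
  have habs : Tendsto (fun l => ∫ x, |f (V l x, W l x) - f (U l x, W l x)| ∂ν) atTop (𝓝 0) := by
    refine tendsto_integral_abs_of_small (M := 2 * ‖f‖) (fun l x => ?_) fun ε hε δ hδ => ?_
    · exact f.dist_le_two_norm _ _
    obtain ⟨J, η, hη, hJ⟩ := exists_forall_abs_sub_lt f.continuous hε
    have hδ2 : 0 < δ / 2 := ENNReal.half_pos hδ.ne'
    obtain ⟨K, hK⟩ := exists_eventually_measure_sum_ge_lt hΦ_fin hU J hδ2
    -- Where the partial sums are at most `K`, the relative error is then at most `η / 4`; the other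
    -- `η / 4` is for `a l * C x`.
    obtain ⟨C, hCm, hC⟩ := hclose (η / 4 / (K + 1)) (by positivity)
    obtain ⟨L, hL0, hL⟩ := exists_measure_lt_le (ν := ν) hCm hδ2
    have haL : ∀ᶠ l in atTop, a l * L < η / 4 := by
      have := ha.mul_const L
      rw [zero_mul] at this
      exact this.eventually_lt_const (by positivity)
    filter_upwards [hK, haL] with l hKl haLl
    refine ⟨{x | (K : ℝ≥0∞) ≤ ∑ i ∈ Finset.range J, U l x i} ∪ {x | L < C x}, ?_, ?_⟩
    · calc _ ≤ _ := measure_union_le _ _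
        _ ≤ δ / 2 + δ / 2 := add_le_add hKl.le hL
        _ = δ := ENNReal.add_halves δ
    · filter_upwards [hfin, hC] with x hx hCx hxB
      simp only [Set.mem_union, Set.mem_ofPred_eq, not_or, not_le, not_lt] at hxB
      have hsum : ∀ j ≤ J, ∑ i ∈ Finset.range j, (U l x i).toReal ≤ K := fun j hj => by
        rw [← ENNReal.toReal_sum fun i _ => (hx l i).1]
        refine ENNReal.toReal_le_of_le_ofReal K.cast_nonneg ?_
        rw [ENNReal.ofReal_natCast]
        exact (Finset.sum_le_sum_of_subset (Finset.range_mono hj)).trans hxB.1.le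
      have hdiff : ∀ j ≤ J, |∑ i ∈ Finset.range j, (V l x i).toReal -
          ∑ i ∈ Finset.range j, (U l x i).toReal| < η / 2 := fun j hj => by
        have h1 : a l * C x ≤ a l * L := mul_le_mul_of_nonneg_left hxB.2 (ha0 l)
        have h2 : η / 4 / (K + 1) * ∑ i ∈ Finset.range j, (U l x i).toReal ≤ η / 4 := by
          calc _ ≤ η / 4 / (K + 1) * (K + 1) := by
                gcongr
                linarith [hsum j hj]
            _ = η / 4 := by field_simp
        linarith [hCx l j]
      refine (hJ _ _ _ fun j hj => ⟨(hx l j).2, (hx l j).1, ?_⟩).le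
      -- Entry `j` is the difference of the partial sums of lengths `j + 1` and `j`, each off by
      -- less than `η / 2`.
      have h1 := abs_lt.1 (hdiff j hj.le)
      have h2 := abs_lt.1 (hdiff (j + 1) hj)
      rw [Finset.sum_range_succ, Finset.sum_range_succ] at h2
      rw [abs_lt]
      constructor <;> linarith [h1.1, h1.2, h2.1, h2.2]
  have hdiff : Tendsto (fun l => ∫ x, (f (V l x, W l x) - f (U l x, W l x)) ∂ν) atTop (𝓝 0) :=
    squeeze_zero_norm (fun l => norm_integral_le_integral_norm _) habs
  have := hdiff.add hUf
  rw [zero_add] at this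
  refine this.congr fun l => ?_
  rw [integral_sub (hint _ (hV l)) (hint _ (hUm l)), sub_add_cancel]

end Convergence

/-! ### Changing the initial measure. -/

section Mixing

variable {X : Type*} [MeasurableSpace X] {μ : Measure X} [IsProbabilityMeasure μ] {T : X → X}

/-- Dividing the pointwise bound `C(x) + n ε / 2` by `n` gives convergence in measure, and
boundedness of `g` upgrades it to convergence in mean. -/
theorem tendsto_integral_abs_birkhoffSum_div_sub (hT : Ergodic T μ) {g : X → ℝ}
    (hgm : Measurable g) {M : ℝ} (hg : ∀ x, |g x| ≤ M) :
    Tendsto (fun n : ℕ => ∫ x, |birkhoffSum T g n x / n - ∫ y, g y ∂μ| ∂μ) atTop (𝓝 0) := by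
  have hint : Integrable g μ := .of_bound hgm.aestronglyMeasurable M (.of_forall hg)
  set c := ∫ y, g y ∂μ
  have hM : 0 ≤ M := by
    obtain ⟨x⟩ := μ.nonempty_of_neZero
    exact (abs_nonneg _).trans (hg x)
  refine tendsto_integral_abs_of_small (M := M + |c|) (fun n x => ?_) fun ε hε δ hδ => ?_
  · refine (abs_sub _ _).trans ?_
    gcongr
    rw [abs_div, Nat.abs_cast]
    refine div_le_of_le_mul₀ n.cast_nonneg hM ?_
    calc |birkhoffSum T g n x| ≤ ∑ k ∈ Finset.range n, |g (T^[k] x)| :=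
          Finset.abs_sum_le_sum_abs _ _
      _ ≤ ∑ _k ∈ Finset.range n, M := Finset.sum_le_sum fun k _ => hg _
      _ = M * n := by simp [mul_comm]
  · obtain ⟨C, hCm, hC⟩ := exists_abs_birkhoffSum_sub_le hT hgm hint (half_pos hε)
    obtain ⟨L, hL0, hL⟩ := exists_measure_lt_le (ν := μ) hCm hδ
    filter_upwards [eventually_gt_atTop 0, eventually_ge_atTop ⌈2 * L / ε⌉₊] with n hn0 hn
    refine ⟨_, hL, ?_⟩
    filter_upwards [hC] with x hx hxL
    simp only [not_lt] at hxL
    have hn0' : (0 : ℝ) < n := by exact_mod_cast hn0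
    have hnL : 2 * L / ε ≤ n := Nat.ceil_le.1 hn
    rw [div_le_iff₀ hε] at hnL
    have : birkhoffSum T g n x / n - c = (birkhoffSum T g n x - n * c) / n := by field_simp
    rw [this, abs_div, Nat.abs_cast, div_le_iff₀ hn0']
    linarith [hx n]

/-- Asymptotically invariant bounded functions have asymptotically the same mean under an ergodic
measure `μ` and under the conditional measure `μ_Y`. -/
theorem tendsto_integral_cond_sub_integral (hT : Ergodic T μ) {Y : Set X} (hY : MeasurableSet Y)
    (hpos : μ Y ≠ 0) {h : ℕ → X → ℝ} {M : ℝ} (hM : ∀ l x, |h l x| ≤ M)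
    (hm : ∀ l, AEStronglyMeasurable (h l) μ)
    (hinv : Tendsto (fun l => ∫ x, |h l (T x) - h l x| ∂μ) atTop (𝓝 0)) :
    Tendsto (fun l => ∫ x, h l x ∂(cond μ Y) - ∫ x, h l x ∂μ) atTop (𝓝 0) := by
  set g : X → ℝ := Y.indicator 1 with hgdef
  have hgm : Measurable g := measurable_one.indicator hY
  have hg : ∀ x, |g x| ≤ 1 := fun x => by
    by_cases hx : x ∈ Y <;> simp [hgdef, hx]
  have hc : ∫ x, g x ∂μ = μ.real Y := integral_indicator_one hY
  set c := μ.real Y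
  have hc0 : 0 < c := ENNReal.toReal_pos hpos (measure_ne_top _ _)
  have hgk : ∀ k, Measurable fun x => g (T^[k] x) := fun k => hgm.comp (hT.measurable.iterate k)
  have hhint : ∀ l, Integrable (h l) μ := fun l => .of_bound (hm l) M (.of_forall (hM l))
  have hhT : ∀ l, Integrable (fun x => h l (T x)) μ := fun l =>
    hT.toMeasurePreserving.integrable_comp_of_integrable (hhint l)
  have hmul : ∀ {u : X → ℝ}, Integrable u μ → ∀ k, Integrable (fun x => u x * g (T^[k] x)) μ :=
    fun hu k => hu.mul_bdd (hgk k).aestronglyMeasurable (.of_forall fun x => hg _)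
  -- `d 0 l` is `μ(Y)` times the mean under `μ_Y`. By invariance `d k l` also equals the integral of
  -- `h l ∘ T` against `g ∘ T^(k+1)`, so raising `k` costs only the invariance defect of `h l`.
  let d : ℕ → ℕ → ℝ := fun k l => ∫ x, h l x * g (T^[k] x) ∂μ
  have hstep : ∀ k l, |d (k + 1) l - d k l| ≤ ∫ x, |h l (T x) - h l x| ∂μ := fun k l => by
    have hd : d k l = ∫ x, h l (T x) * g (T^[k + 1] x) ∂μ := by
      have := hT.toMeasurePreserving.map_eq
      simp only [d]
      conv_lhs => rw [← this]
      rw [integral_map hT.measurable.aemeasurable (by rw [this]; exact (hmul (hhint l) k).1)]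
      rfl
    rw [hd, ← integral_sub (hmul (hhint l) _) (hmul (hhT l) _)]
    refine abs_integral_le_integral_abs.trans
      (integral_mono ((hmul (hhint l) _).sub (hmul (hhT l) _)).abs ((hhT l).sub (hhint l)).abs
        fun x => ?_)
    simp only
    rw [← sub_mul, abs_mul, abs_sub_comm]
    exact mul_le_of_le_one_right (abs_nonneg _) (hg _)
  have hdk : ∀ k, Tendsto (fun l => d k l - d 0 l) atTop (𝓝 0) := fun k => by
    induction k with
    | zero => simp
    | succ k ih =>
      have := (squeeze_zero_norm (hstep k) hinv).add ih
      simpa using this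
  have hmain : Tendsto (fun l => d 0 l - c * ∫ x, h l x ∂μ) atTop (𝓝 0) := by
    have hM0 : 0 ≤ M := by
      obtain ⟨x⟩ := μ.nonempty_of_neZero
      exact (abs_nonneg _).trans (hM 0 x)
    rw [Metric.tendsto_nhds]
    intro ε hε
    have hb := (tendsto_integral_abs_birkhoffSum_div_sub hT hgm hg).const_mul M
    rw [mul_zero, hc] at hb
    -- The averaging length `n` is fixed before `l` tends to infinity, so only finitely many `d k l
    -- - d 0 l` need to be small.
    obtain ⟨n, hn, hn0⟩ := ((hb.eventually_lt_const (half_pos hε)).and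
      (eventually_gt_atTop 0)).exists
    have hn0' : (0 : ℝ) < n := by exact_mod_cast hn0
    have hav : Tendsto (fun l => (∑ k ∈ Finset.range n, (d k l - d 0 l)) / n) atTop (𝓝 0) := by
      simpa using (tendsto_finsetSum (Finset.range n) fun k _ => hdk k).div_const (n : ℝ)
    filter_upwards [Metric.tendsto_nhds.1 hav (ε / 2) (half_pos hε)] with l hl
    rw [Real.dist_eq, sub_zero] at hl ⊢
    have hbint : Integrable (fun x => birkhoffSum T g n x / n - c) μ :=
      ((integrable_finsetSum _ fun k _ => Integrable.of_bound (hgk k).aestronglyMeasurable 1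
        (.of_forall fun x => hg _)).div_const _).sub (integrable_const _)
    have hbm : Integrable (fun x => h l x * (birkhoffSum T g n x / n - c)) μ :=
      hbint.bdd_mul (hm l) (.of_forall (hM l))
    have hsum : (∑ k ∈ Finset.range n, d k l) / n - c * ∫ x, h l x ∂μ =
        ∫ x, h l x * (birkhoffSum T g n x / n - c) ∂μ := by
      simp only [d]
      rw [← integral_finsetSum _ fun k _ => hmul (hhint l) k, ← integral_div,
        ← integral_const_mul, ← integral_sub ((integrable_finsetSum _ fun k _ =>
          hmul (hhint l) k).div_const _) ((hhint l).const_mul _)]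
      refine integral_congr_ae (.of_forall fun x => ?_)
      simp only [birkhoffSum, ← Finset.mul_sum]
      ring
    have hle : |∫ x, h l x * (birkhoffSum T g n x / n - c) ∂μ| ≤
        M * ∫ x, |birkhoffSum T g n x / n - c| ∂μ := by
      rw [← integral_const_mul]
      refine abs_integral_le_integral_abs.trans (integral_mono hbm.abs (hbint.abs.const_mul M)
        fun x => ?_)
      simp only
      rw [abs_mul]
      gcongr
      exact hM l x
    have hsplit : d 0 l - c * ∫ x, h l x ∂μ =
        ((∑ k ∈ Finset.range n, d k l) / n - c * ∫ x, h l x ∂μ) -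
          (∑ k ∈ Finset.range n, (d k l - d 0 l)) / n := by
      rw [Finset.sum_sub_distrib, Finset.sum_const, Finset.card_range, nsmul_eq_mul]
      field_simp
      ring
    rw [hsplit, hsum]
    linarith [abs_sub (∫ x, h l x * (birkhoffSum T g n x / n - c) ∂μ)
      ((∑ k ∈ Finset.range n, (d k l - d 0 l)) / n)]
  have := hmain.const_mul c⁻¹
  rw [mul_zero] at this
  refine this.congr fun l => ?_
  have hd0 : d 0 l = ∫ x in Y, h l x ∂μ := by
    rw [← integral_indicator hY]
    refine integral_congr_ae (.of_forall fun x => ?_)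
    by_cases hx : x ∈ Y <;> simp [hgdef, hx]
  rw [hd0, ProbabilityTheory.cond, integral_smul_measure, ENNReal.toReal_inv, smul_eq_mul, mul_sub,
    inv_mul_cancel_left₀ hc0.ne']
  rfl

end Mixing

/-! ### The two comparisons for the hitting-time processes. -/

section Processes

theorem aemeasurable_process {X F : Type*} [MeasurableSpace X] [MeasurableSpace F] {μ : Measure X}
    [IsProbabilityMeasure μ] {T : X → X} {A : ℕ → Set X} {ψ : ℕ → X → F} {ν : Measure X}
    (hT : Ergodic T μ) (hA : IsAsymptoticallyRare μ A) (hν : ν ≪ μ) (hψ : ∀ l, Measurable ((A l).domRestrict (ψ l))) {H : X → ℕ → ℝ≥0∞}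
    (hH : Measurable H) (c : ℝ≥0∞) (l : ℕ) :
    AEMeasurable (fun x => ((fun j => c * H x j), localProcess T (A l) (ψ l) x)) ν := by
  refine AEMeasurable.prodMk (Measurable.aemeasurable ?_) (aemeasurable_localProcess hT.measurable
    (hA.measurableSet l) (hψ l) (hν.ae_le (ae_frequently_iterate_mem hT (hA.measurableSet l)
      (hA.pos l))))
  exact measurable_pi_lambda _ fun j => ((measurable_pi_apply j).comp hH).const_mul c

variable {X F Ω : Type*} [MeasurableSpace X] {μ : Measure X} [IsProbabilityMeasure μ] {T : X → X}
  [MetricSpace F] [CompactSpace F] [MeasurableSpace F] [BorelSpace F]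
  [MeasurableSpace Ω] {P : Measure Ω} [IsProbabilityMeasure P] {Y : Set X} {A : ℕ → Set X}
  {ψ : ℕ → X → F} {Φ : Ω → ℕ → ℝ≥0∞} {Ψ : Ω → ℕ → F}

theorem ae_forall_frequently_iterate_mem (hT : Ergodic T μ) (hA : IsAsymptoticallyRare μ A) :
    ∀ᵐ x ∂μ, ∀ l, ∃ᶠ n in atTop, T^[n] x ∈ A l :=
  ae_all_iff.2 fun l => ae_frequently_iterate_mem hT (hA.measurableSet l) (hA.pos l)

theorem IsAsymptoticallyRare.tendsto_toReal (hA : IsAsymptoticallyRare μ A) :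
    Tendsto (fun l => (μ (A l)).toReal) atTop (𝓝 0) :=
  (ENNReal.tendsto_toReal_zero_iff fun _ => measure_ne_top _ _).2 hA.tendsto_zero

/-- The normalized hitting-time and local processes have the same limit laws under `μ` and under
`μ_Y`. -/
theorem tendstoInDistribution_iff_cond [IsProbabilityMeasure (cond μ Y)] (hT : Ergodic T μ)
    (hY : MeasurableSet Y) (hpos : μ Y ≠ 0) (hA : IsAsymptoticallyRare μ A)
    (hψ : ∀ l, Measurable ((A l).domRestrict (ψ l))) (hΦ : Measurable Φ) (hΨ : Measurable Ψ) :
    TendstoInDistribution (fun l x => ((fun j => μ (A l) * hittingTimeProcess T (A l) x j),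
        localProcess T (A l) (ψ l) x)) atTop (fun ω => (Φ ω, Ψ ω)) (fun _ => μ) P ↔
      TendstoInDistribution (fun l x => ((fun j => μ (A l) * hittingTimeProcess T (A l) x j),
        localProcess T (A l) (ψ l) x)) atTop (fun ω => (Φ ω, Ψ ω)) (fun _ => cond μ Y) P := by
  have hm : ∀ l, AEMeasurable (fun x => ((fun j => μ (A l) * hittingTimeProcess T (A l) x j),
      localProcess T (A l) (ψ l) x)) μ := fun l => aemeasurable_process hT hA .rfl hψ
    (measurable_hittingTimeProcess hT.measurable (hA.measurableSet l)) _ l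
  have hZ : AEMeasurable (fun ω => (Φ ω, Ψ ω)) P := (hΦ.prodMk hΨ).aemeasurable
  rw [tendstoInDistribution_iff_integral hm hZ, tendstoInDistribution_iff_integral
    (fun l => (hm l).mono_ac cond_absolutelyContinuous) hZ]
  refine forall_congr' fun f => ?_
  set h : ℕ → X → ℝ := fun l x => f ((fun j => μ (A l) * hittingTimeProcess T (A l) x j),
    localProcess T (A l) (ψ l) x) with hdef
  have hdiff : Tendsto (fun l => ∫ x, h l x ∂(cond μ Y) - ∫ x, h l x ∂μ) atTop (𝓝 0) := by
    refine tendsto_integral_cond_sub_integral hT hY hpos (M := ‖f‖)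
      (fun l x => f.norm_coe_le_norm _)
      (fun l => (f.continuous.measurable.comp_aemeasurable (hm l)).aestronglyMeasurable) ?_
    refine tendsto_integral_abs_of_small (M := 2 * ‖f‖) (fun l x => f.dist_le_two_norm _ _)
      fun ε hε δ hδ => ?_
    obtain ⟨J, η, hη, hJ⟩ := exists_forall_abs_sub_lt f.continuous hε
    filter_upwards [hA.tendsto_zero.eventually_le_const hδ,
      hA.tendsto_toReal.eventually_lt_const hη] with l hl hl'
    -- Off this set, `x` and `T x` have the same next entrance point, so the two pairs differ only
    -- in the first waiting time, by one step of normalized size `μ (A l)`.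
    refine ⟨T ⁻¹' A l, ?_, ?_⟩
    · rwa [hT.measure_preimage (hA.measurableSet l).nullMeasurableSet]
    filter_upwards [ae_frequently_iterate_mem hT (hA.measurableSet l) (hA.pos l)] with x hx hxA
    replace hxA : T x ∉ A l := hxA
    have hTx := frequently_iterate_mem hx 1
    rw [Function.iterate_one] at hTx
    have hfin := firstHit_ne_top_of_frequently hTx
    have hfin' : ∀ y, (∃ᶠ n in atTop, T^[n] y ∈ A l) → ∀ j,
        μ (A l) * hittingTimeProcess T (A l) y j ≠ ∞ := fun y hy j => by
      refine ENNReal.mul_ne_top (measure_ne_top _ _) ?_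
      rw [hittingTimeProcess, Ne, ENat.toENNReal_eq_top]
      exact firstHit_iterate_firstEntrance_ne_top hy j
    simp only [hdef, localProcess_of_notMem (ψ l) hxA hfin]
    refine (hJ _ _ _ fun j _ => ⟨hfin' _ hTx j, hfin' _ hx j, ?_⟩).le
    cases j with
    | zero =>
      have h0 := hfin' _ hTx 0
      rw [hittingTimeProcess_zero_of_notMem hxA, mul_add, mul_one,
        ENNReal.toReal_add h0 (measure_ne_top _ _), sub_add_cancel_left, abs_neg,
        abs_of_nonneg ENNReal.toReal_nonneg]
      exact hl'
    | succ j =>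
      rw [hittingTimeProcess_succ_of_notMem hxA hfin, sub_self, abs_zero]
      exact hη
  constructor
  · intro H
    simpa [hdef] using hdiff.add H
  · intro H
    simpa [hdef] using H.sub hdiff

/-- Along almost every orbit, the normalized hitting-time processes of `A l` under `T` and under
`T_Y` are finite, and their partial sums differ by at most the deviation in Birkhoff's theorem. -/
theorem ae_exists_partialSums (hT : Ergodic T μ) (hY : MeasurableSet Y)
    (hA : IsAsymptoticallyRare μ A) (hAY : ∀ l, A l ⊆ Y) :
    ∀ᵐ x ∂μ, ∀ l, ∃ t : ℕ → ℕ,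
      (∀ j, μ (A l) * hittingTimeProcess T (A l) x j ≠ ∞ ∧
        cond μ Y (A l) * inducedHittingTimeProcess T Y (A l) x j ≠ ∞) ∧
      (∀ j, ∑ i ∈ Finset.range j, (μ (A l) * hittingTimeProcess T (A l) x i).toReal =
        (μ (A l)).toReal * t j) ∧
      ∀ j, ∑ i ∈ Finset.range j,
          (cond μ Y (A l) * inducedHittingTimeProcess T Y (A l) x i).toReal =
        (μ (A l)).toReal / μ.real Y * birkhoffSum T ((T ⁻¹' Y).indicator 1) (t j) x := by
  filter_upwards [ae_forall_frequently_iterate_mem hT hA] with x hx l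
  obtain ⟨p, q, hp, hq, hpq⟩ := exists_hittingTimes (hAY l) (hx l)
  have hpos : μ Y ≠ 0 := ((hA.pos l).trans_le (measure_mono (hAY l))).ne'
  have hcond : cond μ Y (A l) = (μ Y)⁻¹ * μ (A l) := by
    rw [cond_apply hY, Set.inter_eq_self_of_subset_right (hAY l)]
  refine ⟨fun j => ∑ i ∈ Finset.range j, p i, fun j => ⟨?_, ?_⟩, fun j => ?_, fun j => ?_⟩
  · rw [hp]
    exact ENNReal.mul_ne_top (measure_ne_top _ _) (ENNReal.natCast_ne_top _)
  · rw [hq, hcond]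
    exact ENNReal.mul_ne_top (ENNReal.mul_ne_top (ENNReal.inv_ne_top.2 hpos) (measure_ne_top _ _))
      (ENNReal.natCast_ne_top _)
  · simp [hp, Finset.mul_sum]
  · rw [← hpq]
    simp [hq, hcond, Finset.mul_sum, div_eq_inv_mul, measureReal_def]

theorem exists_abs_visits_sub_le (hT : Ergodic T μ) (hY : MeasurableSet Y) {ε : ℝ} (hε : 0 < ε) :
    ∃ C : X → ℝ, Measurable C ∧ ∀ᵐ x ∂μ, ∀ n : ℕ,
      |birkhoffSum T ((T ⁻¹' Y).indicator 1) n x - n * μ.real Y| ≤ C x + n * ε := by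
  have hmeas := hT.measurable hY
  have hint : ∫ x, (T ⁻¹' Y).indicator (1 : X → ℝ) x ∂μ = μ.real Y := by
    rw [integral_indicator_one hmeas, measureReal_def,
      hT.measure_preimage hY.nullMeasurableSet, measureReal_def]
  rw [← hint]
  exact exists_abs_birkhoffSum_sub_le hT (measurable_one.indicator hmeas)
    ((integrable_const (1 : ℝ)).indicator hmeas) hε

/-- Under `μ_Y`, the hitting-time processes under `T` and under `T_Y` have the same limit laws. -/
theorem tendstoInDistribution_iff_induced [IsProbabilityMeasure (cond μ Y)] (hT : Ergodic T μ)
    (hY : MeasurableSet Y) (hpos : μ Y ≠ 0) (hA : IsAsymptoticallyRare μ A) (hAY : ∀ l, A l ⊆ Y)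
    (hψ : ∀ l, Measurable ((A l).domRestrict (ψ l))) (hΦ_fin : ∀ᵐ ω ∂P, ∀ j, Φ ω j < ∞) :
    TendstoInDistribution (fun l x => ((fun j => μ (A l) * hittingTimeProcess T (A l) x j),
        localProcess T (A l) (ψ l) x)) atTop (fun ω => (Φ ω, Ψ ω)) (fun _ => cond μ Y) P ↔
      TendstoInDistribution
        (fun l x => ((fun j => cond μ Y (A l) * inducedHittingTimeProcess T Y (A l) x j),
          localProcess T (A l) (ψ l) x)) atTop (fun ω => (Φ ω, Ψ ω)) (fun _ => cond μ Y) P := by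
  have hac : cond μ Y ≪ μ := cond_absolutelyContinuous
  have hc : 0 < μ.real Y := ENNReal.toReal_pos hpos (measure_ne_top _ _)
  have hsums := hac.ae_le (ae_exists_partialSums hT hY hA hAY)
  set c := μ.real Y
  constructor
  · intro H
    refine tendstoInDistribution_of_close hΦ_fin H (fun l => aemeasurable_process hT hA hac hψ
      (measurable_inducedHittingTimeProcess hT.measurable (hA.measurableSet l) hY) _ l)
      hA.tendsto_toReal (fun l => ENNReal.toReal_nonneg) ?_ fun ε hε => ?_
    · filter_upwards [hsums] with x hx l j
      obtain ⟨t, ht, -⟩ := hx l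
      exact ht j
    -- The factor `c` in `ε * c` cancels the `1 / c` coming from `μ_Y (A l) = μ (A l) / c`.
    · obtain ⟨C, hCm, hC⟩ := exists_abs_visits_sub_le hT hY (mul_pos hε hc)
      refine ⟨fun x => C x / c, hCm.div_const c, ?_⟩
      filter_upwards [hsums, hac.ae_le hC] with x hx hCx l j
      obtain ⟨t, -, hU, hV⟩ := hx l
      rw [hU, hV]
      set N := birkhoffSum T ((T ⁻¹' Y).indicator (1 : X → ℝ)) (t j) x
      have hm : 0 ≤ (μ (A l)).toReal := ENNReal.toReal_nonneg
      set m := (μ (A l)).toReal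
      have e : m / c * N - m * t j = m / c * (N - t j * c) := by field_simp
      rw [e, abs_mul, abs_of_nonneg (by positivity)]
      calc m / c * |N - t j * c| ≤ m / c * (C x + t j * (ε * c)) := by
            gcongr
            exact hCx _
        _ = m * (C x / c) + ε * (m * t j) := by field_simp
  · intro H
    refine tendstoInDistribution_of_close hΦ_fin H (fun l => aemeasurable_process hT hA hac hψ
      (measurable_hittingTimeProcess hT.measurable (hA.measurableSet l)) _ l)
      hA.tendsto_toReal (fun l => ENNReal.toReal_nonneg) ?_ fun ε hε => ?_
    · filter_upwards [hsums] with x hx l j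
      obtain ⟨t, ht, -⟩ := hx l
      exact (ht j).symm
    -- Here the error must be relative to the visit count `N`, while Birkhoff bounds it by the
    -- elapsed time `τ`. The bound `δ ≤ c / 2` gives `τ * c ≤ 2 * (N + C x)`. Then `τ * δ ≤ C x + ε
    -- * N` follows from `δ ≤ ε * c / 2` if `ε ≤ 1`, and from `δ ≤ c / 2` if `ε ≥ 1`.
    · have hδ : 0 < min (c / 2) (ε * c / 2) := by positivity
      obtain ⟨C, hCm, hC⟩ := exists_abs_visits_sub_le hT hY hδ
      refine ⟨fun x => 2 * C x / c, (hCm.const_mul 2).div_const c, ?_⟩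
      filter_upwards [hsums, hac.ae_le hC] with x hx hCx l j
      obtain ⟨t, -, hU, hV⟩ := hx l
      rw [hU, hV]
      have hN := hCx (t j)
      -- At time 0 the deviation vanishes, so the bound reads `0 ≤ C x`.
      have hC0 : 0 ≤ C x := by simpa using hCx 0
      set N := birkhoffSum T ((T ⁻¹' Y).indicator (1 : X → ℝ)) (t j) x
      have hm : 0 ≤ (μ (A l)).toReal := ENNReal.toReal_nonneg
      set m := (μ (A l)).toReal
      set τ : ℝ := (t j : ℝ)
      have hτ0 : 0 ≤ τ := Nat.cast_nonneg _
      set δ := min (c / 2) (ε * c / 2)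
      have hδ1 : τ * δ ≤ τ * (c / 2) := by gcongr; exact min_le_left _ _
      have hδ2 : δ ≤ ε * c / 2 := min_le_right _ _
      have hτ : τ * c ≤ 2 * (N + C x) := by linarith [(abs_le.1 hN).1]
      have hτδ : τ * δ ≤ C x + ε * N := by
        rcases le_total ε 1 with hε1 | hε1
        · calc τ * δ ≤ τ * (ε * c / 2) := by gcongr
            _ = ε / 2 * (τ * c) := by ring
            _ ≤ ε / 2 * (2 * (N + C x)) := by gcongr
            _ ≤ C x + ε * N := by nlinarith
        · have hN0 : 0 ≤ N := Finset.sum_nonneg fun k _ =>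
            Set.indicator_nonneg (fun _ _ => zero_le_one) _
          nlinarith
      have e : m * τ - m / c * N = m / c * (τ * c - N) := by field_simp
      rw [e, abs_mul, abs_of_nonneg (by positivity), abs_sub_comm]
      calc m / c * |N - τ * c| ≤ m / c * (2 * C x + ε * N) := by
            gcongr
            linarith
        _ = m * (2 * C x / c) + ε * (m / c * N) := by ring

end Processes

end RareEvents

theorem mainTheorem12 {X F Ω : Type*} [MeasurableSpace X]
    (μ : Measure X) [IsProbabilityMeasure μ] (T : X → X) (hT : Ergodic T μ)
    [MetricSpace F] [CompactSpace F] [MeasurableSpace F] [BorelSpace F]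
    [MeasurableSpace Ω] (P : Measure Ω) [IsProbabilityMeasure P]
    (Y : Set X) (hY : MeasurableSet Y)
    (A : ℕ → Set X) (hA : RareEvents.IsAsymptoticallyRare μ A) (hAY : ∀ l, A l ⊆ Y)
    (ψ : ℕ → X → F) (hψ : ∀ l, Measurable ((A l).domRestrict (ψ l)))
    (Φ : Ω → ℕ → ℝ≥0∞) (hΦ : Measurable Φ) (hΦ_fin : ∀ᵐ ω ∂P, ∀ j, Φ ω j < ∞)
    (Ψ : Ω → ℕ → F) (hΨ : Measurable Ψ) :
    haveI : IsProbabilityMeasure (cond μ Y) := hA.isProbabilityMeasure_cond hAY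
    (TendstoInDistribution
        (fun l x =>
          ((fun j => μ (A l) * RareEvents.hittingTimeProcess T (A l) x j),
            RareEvents.localProcess T (A l) (ψ l) x))
        atTop (fun ω => (Φ ω, Ψ ω)) (fun _ => μ) P ↔
      TendstoInDistribution
        (fun l x =>
          ((fun j => cond μ Y (A l) * RareEvents.inducedHittingTimeProcess T Y (A l) x j),
            RareEvents.localProcess T (A l) (ψ l) x))
        atTop (fun ω => (Φ ω, Ψ ω)) (fun _ => cond μ Y) P) := by
  have hpos : μ Y ≠ 0 := ((hA.pos 0).trans_le (measure_mono (hAY 0))).ne'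
  have : IsProbabilityMeasure (cond μ Y) := hA.isProbabilityMeasure_cond hAY
  exact (RareEvents.tendstoInDistribution_iff_cond hT hY hpos hA hψ hΦ hΨ).trans
    (RareEvents.tendstoInDistribution_iff_induced hT hY hpos hA hAY hψ hΦ_fin)
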